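/- Let $p\ge 1$ be a real number. For a group $G$ with a finite symmetric generating set $S$ (equipped with the word metric of $S$), let $D_p(G)$ be the space of functions $f\colon G\to\mathbb{C}$ with $\sum_{g\in G}|f(gs^{-1})-f(g)|^p<\infty$ for all $s\in S$, normed by $$\|f\|_{D_p}=\Bigl(\sum_{s\in S}\sum_{g\in G}|f(gs^{-1})-f(g)|^p+|f(e_G)|^p\Bigr)^{1/p},$$ and let $BD_p(G)$ be the algebra (under pointwise operations) of bounded functions in $D_p(G)$. Let $Sp(BD_p(G))$ be the set of characters of $BD_p(G)$, i.e. of nonzero algebra homomorphisms $BD_p(G)\to\mathbb{C}$, with the weak-$*$ topology, and let $i_G\colon G\to Sp(BD_p(G))$ be given by $i_G(g)(f)=f(g)$. The $p$-harmonic boundary $\partial_p(G)$ is the subspace of all $x\in Sp(BD_p(G))\setminus i_G(G)$ such that $x(f)=0$ for every bounded function $f$ in the $D_p$-closure of the finitely supported functions on $G$. A map $\phi\colon X\to Y$ of metric spaces is a rough isometry if there are constants $a\ge 1$, $b\ge 0$, $c>0$ such that $\frac1a d_X(x_1,x_2)-b\le d_Y(\phi(x_1),\phi(x_2))\le a\,d_X(x_1,x_2)+b$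 for all $x_1,x_2\in X$, and every $y\in Y$ satisfies $d_Y(\phi(x),y)<c$ for some $x\in X$. Theorem. Let $G$ and $H$ be finitely generated groups with finite symmetric generating sets $S$ and $T$, and let $\phi\colon G\to H$ be a rough isometry for the word metrics. Then $\partial_p(G)$ is homeomorphic to $\partial_p(H)$. More precisely, there is a homeomorphism $\bar\phi\colon\partial_p(G)\to\partial_p(H)$ such that for every $x\in\partial_p(G)$ and every sequence (more generally, every net or filter) of elements $g$ of $G$ with $i_G(g)\to x$ in $Sp(BD_p(G))$, one has $i_H(\phi(g))\to\bar\phi(x)$ in $Sp(BD_p(H))$. -/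

import Mathlib

open Filter Topology

noncomputable section

namespace PHarmonic

universe u

variable {G : Type u} [Group G]

/-- `S` is a finite symmetric generating set of the group `G`. -/
structure IsSymmGen (S : Finset G) : Prop where
  inv_mem : ∀ s ∈ S, s⁻¹ ∈ S
  closure_eq_top : Subgroup.closure (S : Set G) = ⊤

/-- The word metric: the graph distance in the Cayley graph, whose edges join `g` and `g * s`,
`s ∈ S`. -/
def wordDist (S : Finset G) (g h : G) : ℝ :=
  ((SimpleGraph.mulCayley (S : Set G)).dist g h : ℝ)

/-- `φ` is a rough isometry with respect to the distance functions `dX` and `dY`. -/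
def IsRoughIsometry {X Y : Type*} (dX : X → X → ℝ) (dY : Y → Y → ℝ) (φ : X → Y) : Prop :=
  (∃ a b : ℝ, 1 ≤ a ∧ 0 ≤ b ∧ ∀ x₁ x₂ : X,
    1 / a * dX x₁ x₂ - b ≤ dY (φ x₁) (φ x₂) ∧ dY (φ x₁) (φ x₂) ≤ a * dX x₁ x₂ + b) ∧
  ∃ c : ℝ, 0 < c ∧ ∀ y : Y, ∃ x : X, dY (φ x) y < c

/-- Membership in `D_p(G)`. -/
def MemDp (S : Finset G) (p : ℝ) (f : G → ℂ) : Prop :=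
  ∀ s ∈ S, Summable fun g : G => ‖f (g * s⁻¹) - f g‖ ^ p

/-- The norm of `D_p(G)`:
`(∑ s ∈ S, ∑ g, |f(g s⁻¹) - f(g)| ^ p + |f(e)| ^ p) ^ (1/p)`. -/
def dpNorm (S : Finset G) (p : ℝ) (f : G → ℂ) : ℝ :=
  ((∑ s ∈ S, ∑' g : G, ‖f (g * s⁻¹) - f g‖ ^ p) + ‖f 1‖ ^ p) ^ (1 / p)

/-- Membership in the closure, in `D_p(G)` with its norm, of the finitely supported functions. -/
def MemClosureFinSupp (S : Finset G) (p : ℝ) (f : G → ℂ) : Prop :=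
  MemDp S p f ∧ ∀ ε : ℝ, 0 < ε → ∃ u : G → ℂ, u.support.Finite ∧ dpNorm S p (f - u) < ε

theorem summable_norm_add {ι : Type*} {p : ℝ} (hp : 1 ≤ p) {a b : ι → ℂ}
    (ha : Summable fun i => ‖a i‖ ^ p) (hb : Summable fun i => ‖b i‖ ^ p) :
    Summable fun i => ‖a i + b i‖ ^ p := by
  have h0 : (ENNReal.ofReal p).toReal = p := ENNReal.toReal_ofReal (by linarith)
  have hpos : 0 < (ENNReal.ofReal p).toReal := by rw [h0]; linarith
  have ha' : Memℓp a (ENNReal.ofReal p) := by rw [memℓp_gen_iff hpos, h0]; exact ha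
  have hb' : Memℓp b (ENNReal.ofReal p) := by rw [memℓp_gen_iff hpos, h0]; exact hb
  have h := ha'.add hb'
  rw [memℓp_gen_iff hpos, h0] at h
  exact h

theorem summable_norm_mul {ι : Type*} {p : ℝ} (hp : 1 ≤ p) {a b : ι → ℂ} {C : ℝ}
    (ha : ∀ i, ‖a i‖ ≤ C) (hb : Summable fun i => ‖b i‖ ^ p) :
    Summable fun i => ‖a i * b i‖ ^ p := by
  refine Summable.of_nonneg_of_le (fun i => by positivity) (fun i => ?_) (hb.mul_left (C ^ p))
  rw [norm_mul, Real.mul_rpow (norm_nonneg _) (norm_nonneg _)]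
  exact mul_le_mul_of_nonneg_right
    (Real.rpow_le_rpow (norm_nonneg _) (ha i) (by linarith)) (by positivity)

/-- `BD_p(G)`: the algebra, under pointwise operations, of the bounded functions in `D_p(G)`. -/
def BD (S : Finset G) {p : ℝ} (hp : 1 ≤ p) : Subalgebra ℂ (G → ℂ) where
  carrier := {f | (∃ C : ℝ, ∀ g, ‖f g‖ ≤ C) ∧ MemDp S p f}
  add_mem' := by
    rintro f g ⟨⟨C, hC⟩, hf⟩ ⟨⟨C', hC'⟩, hg⟩
    refine ⟨⟨C + C', fun x => (norm_add_le _ _).trans (add_le_add (hC x) (hC' x))⟩, fun s hs => ?_⟩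
    refine (summable_norm_add hp (hf s hs) (hg s hs)).congr fun x => ?_
    simp only [Pi.add_apply]
    congr 2
    ring
  mul_mem' := by
    rintro f g ⟨⟨C, hC⟩, hf⟩ ⟨⟨C', hC'⟩, hg⟩
    refine ⟨⟨C * C', fun x => ?_⟩, fun s hs => ?_⟩
    · simp only [Pi.mul_apply, norm_mul]
      exact mul_le_mul (hC x) (hC' x) (norm_nonneg _) ((norm_nonneg _).trans (hC x))
    · refine (summable_norm_add hp
        (summable_norm_mul hp (fun x : G => hC (x * s⁻¹)) (hg s hs))
        (summable_norm_mul hp hC' (hf s hs))).congr fun x => ?_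
      simp only [Pi.mul_apply]
      congr 2
      ring
  algebraMap_mem' := by
    intro c
    refine ⟨⟨‖c‖, fun x => le_of_eq rfl⟩, fun s _ => ?_⟩
    have : p ≠ 0 := by linarith
    simp [Real.zero_rpow this]

/-- `Sp(BD_p(G))`: the characters of `BD_p(G)`, that is, its nonzero (multiplicative, `ℂ`-linear)
homomorphisms into `ℂ`. -/
def Spec (S : Finset G) {p : ℝ} (hp : 1 ≤ p) : Type u :=
  {τ : BD S hp →ₙₐ[ℂ] ℂ // τ ≠ 0}

/-- The weak-* topology: the coarsest one for which all evaluations `τ ↦ τ f` are continuous. -/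
instance (S : Finset G) {p : ℝ} (hp : 1 ≤ p) : TopologicalSpace (Spec S hp) :=
  TopologicalSpace.induced (fun τ (f : BD S hp) => τ.1 f) Pi.topologicalSpace

/-- The evaluation `f ↦ f g`, as a homomorphism. -/
def evalHom (S : Finset G) {p : ℝ} (hp : 1 ≤ p) (g : G) : BD S hp →ₙₐ[ℂ] ℂ where
  toFun f := (f : G → ℂ) g
  map_smul' _ _ := rfl
  map_zero' := rfl
  map_add' _ _ := rfl
  map_mul' _ _ := rfl

/-- The map `i : G → Sp(BD_p(G))`, `i(g)(f) = f(g)`. -/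
def toSpec (S : Finset G) {p : ℝ} (hp : 1 ≤ p) (g : G) : Spec S hp :=
  ⟨evalHom S hp g, fun h => one_ne_zero (α := ℂ) (DFunLike.congr_fun h (1 : BD S hp))⟩

/-- The `p`-harmonic boundary `∂_p(G)`, with the subspace topology of `Sp(BD_p(G))`. -/
def boundary (S : Finset G) {p : ℝ} (hp : 1 ≤ p) : Set (Spec S hp) :=
  {x | x ∉ Set.range (toSpec S hp) ∧
    ∀ f : BD S hp, MemClosureFinSupp S p (f : G → ℂ) → x.1 f = 0}

end PHarmonic

end

/-!
Composition with a rough isometry `φ` maps `D_p(H)` boundedly into `D_p(G)`: the `ℓ^p` norm of a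
difference along any fixed group element is controlled by those along the generators, and the
fibres of `φ` are uniformly finite. It also preserves the closure of the finitely supported
functions, so it induces a continuous map of spectra that sends the boundary into the boundary.
If `ψ` is a rough inverse of `φ`, then `f ∘ ψ ∘ φ - f` lies in `ℓ^p` for every `f` in `D_p(G)`,
hence in the closure of the finitely supported functions. Characters in the boundary do not see
this difference, so there the maps induced by `φ` and `ψ` are inverse to each other.
-/

namespace PHarmonic

open scoped ENNReal Pointwise

section PowerSums

variable {ι E : Type*} [NormedAddCommGroup E] {p : ℝ}

theorem enorm_sub_rpow_le (hp : 1 ≤ p) (a b c : E) :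
    ‖a - c‖ₑ ^ p ≤ 2 ^ (p - 1) * (‖a - b‖ₑ ^ p + ‖b - c‖ₑ ^ p) := by
  have triangle : ‖a - c‖ₑ ≤ ‖a - b‖ₑ + ‖b - c‖ₑ := by
    simpa only [sub_add_sub_cancel] using enorm_add_le (a - b) (b - c)
  exact (ENNReal.rpow_le_rpow triangle (zero_le_one.trans hp)).trans
    (ENNReal.rpow_add_le_mul_rpow_add_rpow _ _ hp)

theorem tsum_enorm_sub_rpow_le (hp : 1 ≤ p) (a b c : ι → E) :
    ∑' i, ‖a i - c i‖ₑ ^ p ≤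
      2 ^ (p - 1) * (∑' i, ‖a i - b i‖ₑ ^ p + ∑' i, ‖b i - c i‖ₑ ^ p) := by
  rw [← ENNReal.tsum_add, ← ENNReal.tsum_mul_left]
  exact ENNReal.tsum_le_tsum fun i => enorm_sub_rpow_le hp _ _ _

theorem summable_norm_rpow_iff (hp : 0 ≤ p) (a : ι → E) :
    (Summable fun i => ‖a i‖ ^ p) ↔ ∑' i, ‖a i‖ₑ ^ p ≠ ∞ := by
  simp only [enorm_eq_nnnorm, ← ENNReal.coe_rpow_of_nonneg _ hp,
    ENNReal.tsum_coe_ne_top_iff_summable, ← NNReal.summable_coe, NNReal.coe_rpow, coe_nnnorm]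

theorem toReal_tsum_enorm_rpow (hp : 0 ≤ p) (a : ι → E) :
    (∑' i, ‖a i‖ₑ ^ p).toReal = ∑' i, ‖a i‖ ^ p := by
  rw [ENNReal.tsum_toReal_eq fun i => ENNReal.rpow_ne_top_of_nonneg hp enorm_ne_top]
  simp only [← ENNReal.toReal_rpow, toReal_enorm]

theorem tsum_enorm_rpow_ne_top_of_finite_support (hp : 0 < p) {u : ι → E}
    (hu : u.support.Finite) : ∑' i, ‖u i‖ₑ ^ p ≠ ∞ := by
  have vanish : ∀ i ∉ hu.toFinset, ‖u i‖ₑ ^ p = 0 := fun i hi => by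
    rw [Function.notMem_support.1 (mt hu.mem_toFinset.2 hi), enorm_zero,
      ENNReal.zero_rpow_of_pos hp]
  rw [tsum_eq_sum vanish]
  exact ENNReal.sum_ne_top.2 fun i _ => ENNReal.rpow_ne_top_of_nonneg hp.le enorm_ne_top

theorem exists_finite_support_tsum_enorm_sub_rpow_lt (hp : 0 < p) {f : ι → E}
    (hf : ∑' i, ‖f i‖ₑ ^ p ≠ ∞) {ε : ℝ≥0∞} (hε : ε ≠ 0) :
    ∃ u : ι → E, u.support.Finite ∧ ∑' i, ‖(f - u) i‖ₑ ^ p < ε := by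
  classical
  obtain ⟨A, hA⟩ := ((ENNReal.tendsto_tsum_compl_atTop_zero hf).eventually_lt_const
    hε.bot_lt).exists
  refine ⟨(A : Set ι).indicator f, A.finite_toSet.subset Set.support_indicator_subset, ?_⟩
  refine hA.trans_eq' <| (tsum_subtype {i | i ∉ A} fun i => ‖f i‖ₑ ^ p).trans <|
    tsum_congr fun i => ?_
  by_cases hi : i ∈ A <;> simp [hi, hp]

theorem tsum_comp_le_of_encard_fiber_le {X Y : Type*} {φ : X → Y} {n : ℕ∞}
    (hφ : ∀ y, (φ ⁻¹' {y}).encard ≤ n) (A : Y → ℝ≥0∞) :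
    ∑' x, A (φ x) ≤ n * ∑' y, A y := by
  rw [← ENNReal.tsum_fiberwise _ φ, ← ENNReal.tsum_mul_left]
  refine ENNReal.tsum_le_tsum fun y => ?_
  calc ∑' x : φ ⁻¹' {y}, A (φ x)
      = ∑' _ : φ ⁻¹' {y}, A y := tsum_congr fun x => congrArg A x.2
    _ = (φ ⁻¹' {y}).encard * A y := ENNReal.tsum_set_const _ _
    _ ≤ n * A y := by gcongr; exact hφ y

end PowerSums

section Energy

variable {G E : Type*} [Group G] [NormedAddCommGroup E] {S : Finset G} {p : ℝ}

/-- The `p`-th power of the `ℓ^p` norm of the difference of `F` along right translation by `w`. -/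
noncomputable def translationEnergy (p : ℝ) (w : G) (F : G → E) : ℝ≥0∞ :=
  ∑' g : G, ‖F (g * w) - F g‖ₑ ^ p

/-- The `p`-Dirichlet energy `∑ s ∈ S, ∑ g, |F(g s⁻¹) - F(g)| ^ p`, which is `∞` if `F` is not in
`D_p`. -/
noncomputable def dirichletEnergy (S : Finset G) (p : ℝ) (F : G → E) : ℝ≥0∞ :=
  ∑ s ∈ S, translationEnergy p s⁻¹ F

/-- The `p`-th power of the norm of `D_p`, which is `∞` if `F` is not in `D_p`. -/
noncomputable def dpNormPow (S : Finset G) (p : ℝ) (F : G → E) : ℝ≥0∞ :=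
  dirichletEnergy S p F + ‖F 1‖ₑ ^ p

theorem translationEnergy_one (hp : 0 < p) (F : G → E) : translationEnergy p 1 F = 0 := by
  simp [translationEnergy, hp]

theorem translationEnergy_inv (w : G) (F : G → E) :
    translationEnergy p w⁻¹ F = translationEnergy p w F := by
  unfold translationEnergy
  rw [← (Equiv.mulRight w).tsum_eq]
  simp only [Equiv.coe_mulRight, mul_inv_cancel_right, enorm_sub_rev]

theorem translationEnergy_mul_le (hp : 1 ≤ p) (v w : G) (F : G → E) :
    translationEnergy p (v * w) F ≤
      2 ^ (p - 1) * (translationEnergy p w F + translationEnergy p v F) := by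
  have shift : translationEnergy p w F = ∑' g, ‖F (g * (v * w)) - F (g * v)‖ₑ ^ p := by
    unfold translationEnergy
    rw [← (Equiv.mulRight v).tsum_eq]
    simp only [Equiv.coe_mulRight, mul_assoc]
  rw [shift]
  exact tsum_enorm_sub_rpow_le hp _ _ _

theorem exists_translationEnergy_le (hS : Subgroup.closure (S : Set G) = ⊤) (hp : 1 ≤ p) (w : G) :
    ∃ C ≠ ∞, ∀ F : G → E, translationEnergy p w F ≤ C * dirichletEnergy S p F := by
  induction hS ▸ Subgroup.mem_top w using Subgroup.closure_induction with
  | mem s hs =>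
    refine ⟨1, ENNReal.one_ne_top, fun F => ?_⟩
    rw [← translationEnergy_inv, one_mul]
    exact Finset.single_le_sum (f := fun s => translationEnergy p s⁻¹ F) (fun _ _ => zero_le) hs
  | one =>
    refine ⟨0, ENNReal.zero_ne_top, fun F => ?_⟩
    simp [translationEnergy_one (zero_lt_one.trans_le hp)]
  | mul v w _ _ hv hw =>
    obtain ⟨A, hA, hv⟩ := hv
    obtain ⟨B, hB, hw⟩ := hw
    refine ⟨2 ^ (p - 1) * (B + A), by finiteness, fun F => ?_⟩
    calc translationEnergy p (v * w) F
        ≤ 2 ^ (p - 1) * (translationEnergy p w F + translationEnergy p v F) :=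
          translationEnergy_mul_le hp v w F
      _ ≤ 2 ^ (p - 1) * (B * dirichletEnergy S p F + A * dirichletEnergy S p F) := by
          gcongr
          exacts [hw F, hv F]
      _ = 2 ^ (p - 1) * (B + A) * dirichletEnergy S p F := by ring
  | inv v _ hv => simpa only [translationEnergy_inv] using hv

theorem translationEnergy_le_tsum (hp : 1 ≤ p) (w : G) (F : G → E) :
    translationEnergy p w F ≤ 2 ^ (p - 1) * 2 * ∑' g, ‖F g‖ₑ ^ p := by
  have shift : ∑' g, ‖F (g * w)‖ₑ ^ p = ∑' g, ‖F g‖ₑ ^ p :=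
    (Equiv.mulRight w).tsum_eq fun g => ‖F g‖ₑ ^ p
  have := tsum_enorm_sub_rpow_le hp (fun g => F (g * w)) (fun _ => 0) F
  simpa only [translationEnergy, sub_zero, zero_sub, enorm_neg, shift, ← two_mul, mul_assoc]
    using this

variable (S) in
theorem exists_dpNormPow_le_tsum (hp : 1 ≤ p) :
    ∃ C ≠ ∞, ∀ F : G → E, dpNormPow S p F ≤ C * ∑' g, ‖F g‖ₑ ^ p := by
  refine ⟨S.card * (2 ^ (p - 1) * 2) + 1, by finiteness, fun F => ?_⟩
  rw [add_mul, one_mul, mul_assoc, ← nsmul_eq_mul]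
  exact add_le_add
    (Finset.sum_le_card_nsmul _ _ _ fun s _ => translationEnergy_le_tsum hp s⁻¹ F)
    (ENNReal.le_tsum 1)

end Energy

section Dirichlet

variable {G : Type*} [Group G] {S : Finset G} {p : ℝ} {f u : G → ℂ}

theorem memDp_iff_dirichletEnergy_ne_top (hp : 0 ≤ p) :
    MemDp S p f ↔ dirichletEnergy S p f ≠ ∞ := by
  simp only [MemDp, dirichletEnergy, translationEnergy, summable_norm_rpow_iff hp,
    ENNReal.sum_ne_top]

theorem MemDp.sub (hp : 1 ≤ p) (hf : MemDp S p f) (hu : MemDp S p u) : MemDp S p (f - u) :=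
  fun s hs => by
    have hneg : Summable fun g => ‖-(u (g * s⁻¹) - u g)‖ ^ p := by
      simpa only [norm_neg] using hu s hs
    refine (summable_norm_add hp (hf s hs) hneg).congr fun g => ?_
    rw [← sub_eq_add_neg, sub_sub_sub_comm, Pi.sub_apply, Pi.sub_apply]

theorem memDp_of_tsum_ne_top (hp : 1 ≤ p) (hf : ∑' g, ‖f g‖ₑ ^ p ≠ ∞) : MemDp S p f := by
  obtain ⟨C, hC, hle⟩ := exists_dpNormPow_le_tsum (E := ℂ) S hp
  exact (memDp_iff_dirichletEnergy_ne_top (zero_le_one.trans hp)).2 <|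
    ne_top_of_le_ne_top (ENNReal.mul_ne_top hC hf) (le_self_add.trans (hle f))

theorem dpNorm_eq_toReal_dpNormPow (hp : 0 ≤ p) (hf : MemDp S p f) :
    dpNorm S p f = (dpNormPow S p f).toReal ^ (1 / p) := by
  have hE := (memDp_iff_dirichletEnergy_ne_top hp).1 hf
  rw [dpNorm, dpNormPow, ENNReal.toReal_add hE (by finiteness), dirichletEnergy,
    ENNReal.toReal_sum (ENNReal.sum_ne_top.1 hE), ← ENNReal.toReal_rpow, toReal_enorm]
  simp only [translationEnergy, toReal_tsum_enorm_rpow hp]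

theorem dpNorm_lt_iff (hp : 0 < p) (hf : MemDp S p f) {ε : ℝ} (hε : 0 ≤ ε) :
    dpNorm S p f < ε ↔ dpNormPow S p f < ENNReal.ofReal (ε ^ p) := by
  have hE := (memDp_iff_dirichletEnergy_ne_top hp.le).1 hf
  have hN : dpNormPow S p f ≠ ∞ := ENNReal.add_ne_top.2 ⟨hE, by finiteness⟩
  rw [dpNorm_eq_toReal_dpNormPow hp.le hf, ENNReal.lt_ofReal_iff_toReal_lt hN, one_div,
    Real.rpow_inv_lt_iff_of_pos ENNReal.toReal_nonneg hε hp]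

theorem memClosureFinSupp_iff (hp : 1 ≤ p) :
    MemClosureFinSupp S p f ↔ MemDp S p f ∧
      ∀ ε : ℝ≥0∞, ε ≠ 0 → ∃ u : G → ℂ, u.support.Finite ∧ dpNormPow S p (f - u) < ε := by
  have hp0 : 0 < p := zero_lt_one.trans_le hp
  refine and_congr_right fun hf => ?_
  have hfu {u : G → ℂ} (hu : u.support.Finite) : MemDp S p (f - u) :=
    hf.sub hp (memDp_of_tsum_ne_top hp (tsum_enorm_rpow_ne_top_of_finite_support hp0 hu))
  constructor
  · intro h ε hε
    obtain ⟨δ, hδ, hδε⟩ := ENNReal.lt_iff_exists_nnreal_btwn.1 hε.bot_lt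
    have hδ0 : (0 : ℝ) < δ := NNReal.coe_pos.2 (ENNReal.coe_pos.1 hδ)
    obtain ⟨u, hu, hlt⟩ := h (δ ^ p⁻¹) (by positivity)
    rw [dpNorm_lt_iff hp0 (hfu hu) (by positivity), Real.rpow_inv_rpow hδ0.le hp0.ne',
      ENNReal.ofReal_coe_nnreal] at hlt
    exact ⟨u, hu, hlt.trans hδε⟩
  · intro h ε hε
    obtain ⟨u, hu, hlt⟩ := h (ENNReal.ofReal (ε ^ p)) (by simpa using Real.rpow_pos_of_pos hε p)
    exact ⟨u, hu, (dpNorm_lt_iff hp0 (hfu hu) hε.le).2 hlt⟩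

theorem memClosureFinSupp_of_tsum_ne_top (hp : 1 ≤ p) (hf : ∑' g, ‖f g‖ₑ ^ p ≠ ∞) :
    MemClosureFinSupp S p f := by
  refine (memClosureFinSupp_iff hp).2 ⟨memDp_of_tsum_ne_top hp hf, fun ε hε => ?_⟩
  obtain ⟨C, hC, hle⟩ := exists_dpNormPow_le_tsum (E := ℂ) S hp
  obtain ⟨u, hu, hlt⟩ := exists_finite_support_tsum_enorm_sub_rpow_lt (zero_lt_one.trans_le hp) hf
    (ENNReal.div_pos hε hC).ne'
  exact ⟨u, hu, (hle _).trans_lt (ENNReal.mul_lt_of_lt_div' hlt)⟩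

end Dirichlet

section RegularMaps

variable {ι G H E : Type*} [Group G] [Group H] [NormedAddCommGroup E] {S : Finset G}
  {T : Finset H} {p : ℝ} {φ : G → H}

/-- Two maps into a group are close if the elements carrying one to the other by right
multiplication form a finite set; in a finitely generated group this means that the maps are at
bounded distance for a word metric. -/
def IsClose (φ τ : ι → G) : Prop :=
  (Set.range fun i => (φ i)⁻¹ * τ i).Finite

/-- Regular maps in the sense of Benjamini, Schramm and Timár, that is, Lipschitz maps with
uniformly finite fibres. The Lipschitz condition is stated without generators. -/
structure IsRegular (φ : G → H) : Prop where
  isClose_mul_right : ∀ w, IsClose φ fun g => φ (g * w)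
  exists_encard_fiber_le : ∃ n : ℕ, ∀ h, (φ ⁻¹' {h}).encard ≤ n

theorem IsClose.exists_tsum_enorm_sub_le {φ τ : ι → H} (hφτ : IsClose φ τ) {n : ℕ}
    (hn : ∀ h, (φ ⁻¹' {h}).encard ≤ n) (hT : Subgroup.closure (T : Set H) = ⊤) (hp : 1 ≤ p) :
    ∃ C ≠ ∞, ∀ F : H → E, ∑' i, ‖F (τ i) - F (φ i)‖ₑ ^ p ≤ C * dirichletEnergy T p F := by
  choose C hC hle using exists_translationEnergy_le (E := E) hT hp
  let D := Set.Finite.toFinset hφτ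
  refine ⟨∑ w ∈ D, n * C w, ENNReal.sum_ne_top.2 fun w _ => by have := hC w; finiteness,
    fun F => ?_⟩
  calc ∑' i, ‖F (τ i) - F (φ i)‖ₑ ^ p
      ≤ ∑' i, ∑ w ∈ D, ‖F (φ i * w) - F (φ i)‖ₑ ^ p := by
        refine ENNReal.tsum_le_tsum fun i => ?_
        have hi : (φ i)⁻¹ * τ i ∈ D := (Set.Finite.mem_toFinset hφτ).2 ⟨i, rfl⟩
        simpa only [mul_inv_cancel_left] using
          Finset.single_le_sum (f := fun w => ‖F (φ i * w) - F (φ i)‖ₑ ^ p)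
            (fun _ _ => zero_le) hi
    _ = ∑ w ∈ D, ∑' i, ‖F (φ i * w) - F (φ i)‖ₑ ^ p :=
        Summable.tsum_finsetSum fun _ _ => ENNReal.summable
    _ ≤ ∑ w ∈ D, n * translationEnergy p w F :=
        Finset.sum_le_sum fun w _ =>
          tsum_comp_le_of_encard_fiber_le hn fun h => ‖F (h * w) - F h‖ₑ ^ p
    _ ≤ ∑ w ∈ D, n * (C w * dirichletEnergy T p F) := by
        gcongr with w
        exact hle w F
    _ = (∑ w ∈ D, n * C w) * dirichletEnergy T p F := by
        simp only [Finset.sum_mul, mul_assoc]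

theorem IsRegular.exists_dirichletEnergy_comp_le (hφ : IsRegular φ) (S : Finset G)
    (hT : Subgroup.closure (T : Set H) = ⊤) (hp : 1 ≤ p) :
    ∃ C ≠ ∞, ∀ F : H → E, dirichletEnergy S p (F ∘ φ) ≤ C * dirichletEnergy T p F := by
  obtain ⟨n, hn⟩ := hφ.exists_encard_fiber_le
  choose C hC hle using fun s : G =>
    (hφ.isClose_mul_right s⁻¹).exists_tsum_enorm_sub_le (E := E) hn hT hp
  refine ⟨∑ s ∈ S, C s, ENNReal.sum_ne_top.2 fun s _ => hC s, fun F => ?_⟩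
  rw [Finset.sum_mul]
  exact Finset.sum_le_sum fun s _ => hle s F

theorem exists_enorm_apply_rpow_le (hT : Subgroup.closure (T : Set H) = ⊤) (hp : 1 ≤ p) (h : H) :
    ∃ C ≠ ∞, ∀ F : H → E, ‖F h‖ₑ ^ p ≤ C * dpNormPow T p F := by
  obtain ⟨B, hB, hle⟩ := exists_translationEnergy_le (E := E) hT hp h
  refine ⟨2 ^ (p - 1) * (B + 1), by finiteness, fun F => ?_⟩
  have hdiff : ‖F h - F 1‖ₑ ^ p ≤ translationEnergy p h F := by
    simpa only [translationEnergy, one_mul] using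
      ENNReal.le_tsum (f := fun k => ‖F (k * h) - F k‖ₑ ^ p) 1
  calc ‖F h‖ₑ ^ p
      ≤ 2 ^ (p - 1) * (‖F h - F 1‖ₑ ^ p + ‖F 1‖ₑ ^ p) := by
        simpa only [sub_zero] using enorm_sub_rpow_le hp (F h) (F 1) 0
    _ ≤ 2 ^ (p - 1) * (B * dpNormPow T p F + dpNormPow T p F) := by
        gcongr
        · exact (hdiff.trans (hle F)).trans (mul_le_mul_right le_self_add B)
        · exact le_add_self
    _ = 2 ^ (p - 1) * (B + 1) * dpNormPow T p F := by ring

theorem IsRegular.exists_dpNormPow_comp_le (hφ : IsRegular φ) (S : Finset G)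
    (hT : Subgroup.closure (T : Set H) = ⊤) (hp : 1 ≤ p) :
    ∃ C ≠ ∞, ∀ F : H → E, dpNormPow S p (F ∘ φ) ≤ C * dpNormPow T p F := by
  obtain ⟨A, hA, energy_le⟩ := hφ.exists_dirichletEnergy_comp_le (E := E) S hT hp
  obtain ⟨B, hB, apply_le⟩ := exists_enorm_apply_rpow_le (E := E) hT hp (φ 1)
  refine ⟨A + B, by finiteness, fun F => ?_⟩
  rw [add_mul]
  exact add_le_add ((energy_le F).trans (mul_le_mul_right le_self_add A)) (apply_le F)

theorem IsRegular.memDp_comp (hφ : IsRegular φ) (hT : Subgroup.closure (T : Set H) = ⊤)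
    (hp : 1 ≤ p) {F : H → ℂ} (hF : MemDp T p F) : MemDp S p (F ∘ φ) := by
  obtain ⟨C, hC, hle⟩ := hφ.exists_dirichletEnergy_comp_le (E := ℂ) S hT hp
  rw [memDp_iff_dirichletEnergy_ne_top (zero_le_one.trans hp)] at hF ⊢
  exact ne_top_of_le_ne_top (ENNReal.mul_ne_top hC hF) (hle F)

theorem IsRegular.finite_support_comp (hφ : IsRegular φ) {M : Type*} [Zero M] {u : H → M}
    (hu : u.support.Finite) : (u ∘ φ).support.Finite := by
  obtain ⟨n, hn⟩ := hφ.exists_encard_fiber_le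
  rw [Function.support_comp_eq_preimage]
  exact hu.preimage' fun h _ => Set.finite_of_encard_le_coe (hn h)

theorem IsRegular.memClosureFinSupp_comp (hφ : IsRegular φ)
    (hT : Subgroup.closure (T : Set H) = ⊤) (hp : 1 ≤ p) {F : H → ℂ}
    (hF : MemClosureFinSupp T p F) : MemClosureFinSupp S p (F ∘ φ) := by
  obtain ⟨C, hC, hle⟩ := hφ.exists_dpNormPow_comp_le (E := ℂ) S hT hp
  rw [memClosureFinSupp_iff hp] at hF ⊢
  refine ⟨hφ.memDp_comp hT hp hF.1, fun ε hε => ?_⟩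
  obtain ⟨u, hu, hlt⟩ := hF.2 (ε / C) (ENNReal.div_pos hε hC).ne'
  exact ⟨u ∘ φ, hφ.finite_support_comp hu,
    (hle (F - u)).trans_lt (ENNReal.mul_lt_of_lt_div' hlt)⟩

theorem IsClose.memClosureFinSupp_comp_sub {τ : G → G} (hτ : IsClose id τ)
    (hS : Subgroup.closure (S : Set G) = ⊤) (hp : 1 ≤ p) {f : G → ℂ} (hf : MemDp S p f) :
    MemClosureFinSupp S p (f ∘ τ - f) := by
  obtain ⟨C, hC, hle⟩ := hτ.exists_tsum_enorm_sub_le (E := ℂ) (n := 1)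
    (fun g => (Set.encard_singleton g).le) hS hp
  exact memClosureFinSupp_of_tsum_ne_top hp <| ne_top_of_le_ne_top
    (ENNReal.mul_ne_top hC ((memDp_iff_dirichletEnergy_ne_top (zero_le_one.trans hp)).1 hf))
    (hle f)

end RegularMaps

section Spectrum

variable {G H : Type*} [Group G] [Group H] {S : Finset G} {T : Finset H} {p : ℝ} {hp : 1 ≤ p}
  {φ : G → H} {ψ : H → G}

theorem Spec.apply_one (x : Spec S hp) : x.1 1 = 1 := by
  obtain ⟨f, hf⟩ : ∃ f, x.1 f ≠ 0 := by
    by_contra! h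
    exact x.2 (NonUnitalAlgHom.ext h)
  exact mul_left_cancel₀ hf (by rw [← map_mul, mul_one, mul_one])

theorem Spec.continuous_apply (f : BD S hp) : Continuous fun x : Spec S hp => x.1 f :=
  (_root_.continuous_apply f).comp continuous_induced_dom

/-- Composition with a regular map, as a homomorphism `BD_p(H) → BD_p(G)`. -/
def IsRegular.pullback (hφ : IsRegular φ) (S : Finset G) (hT : Subgroup.closure (T : Set H) = ⊤)
    (hp : 1 ≤ p) : BD T hp →ₙₐ[ℂ] BD S hp where
  toFun f := ⟨(f : H → ℂ) ∘ φ, f.2.1.imp fun _ hC g => hC (φ g), hφ.memDp_comp hT hp f.2.2⟩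
  map_smul' _ _ := rfl
  map_zero' := rfl
  map_add' _ _ := rfl
  map_mul' _ _ := rfl

/-- The map `Sp(BD_p(G)) → Sp(BD_p(H))` induced by a regular map `G → H`. -/
def IsRegular.specMap (hφ : IsRegular φ) (hT : Subgroup.closure (T : Set H) = ⊤)
    (x : Spec S hp) : Spec T hp :=
  ⟨x.1.comp (hφ.pullback S hT hp), fun h => one_ne_zero (α := ℂ) <|
    x.apply_one.symm.trans (DFunLike.congr_fun h (1 : BD T hp))⟩

theorem IsRegular.specMap_toSpec (hφ : IsRegular φ) (hT : Subgroup.closure (T : Set H) = ⊤)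
    (g : G) : hφ.specMap hT (toSpec S hp g) = toSpec T hp (φ g) :=
  rfl

theorem IsRegular.continuous_specMap (hφ : IsRegular φ) (hT : Subgroup.closure (T : Set H) = ⊤) :
    Continuous (hφ.specMap hT : Spec S hp → Spec T hp) :=
  continuous_induced_rng.2 <| continuous_pi fun f => Spec.continuous_apply (hφ.pullback S hT hp f)

-- The indicator function of `g` separates `toSpec S hp g` from the boundary.
theorem mem_boundary_iff {x : Spec S hp} :
    x ∈ boundary S hp ↔ ∀ f : BD S hp, MemClosureFinSupp S p (f : G → ℂ) → x.1 f = 0 := by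
  classical
  refine ⟨fun hx => hx.2, fun hx => ⟨?_, hx⟩⟩
  rintro ⟨g, rfl⟩
  let δ : G → ℂ := Pi.single g 1
  have hδ : MemClosureFinSupp S p δ := memClosureFinSupp_of_tsum_ne_top hp <|
    tsum_enorm_rpow_ne_top_of_finite_support (zero_lt_one.trans_le hp) <|
      (Set.finite_singleton g).subset Pi.support_single_subset
  have hδ_bdd : ∀ k, ‖δ k‖ ≤ 1 := fun k => by
    by_cases hk : k = g <;> simp [δ, hk]
  have hδ_zero : δ g = 0 := hx ⟨δ, ⟨1, hδ_bdd⟩, hδ.1⟩ hδ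
  simp [δ] at hδ_zero

theorem IsRegular.specMap_mem_boundary (hφ : IsRegular φ)
    (hT : Subgroup.closure (T : Set H) = ⊤) {x : Spec S hp} (hx : x ∈ boundary S hp) :
    hφ.specMap hT x ∈ boundary T hp := by
  rw [mem_boundary_iff] at hx ⊢
  exact fun f hf => hx _ (hφ.memClosureFinSupp_comp hT hp hf)

theorem IsRegular.specMap_specMap (hφ : IsRegular φ) (hψ : IsRegular ψ)
    (hψφ : IsClose id (ψ ∘ φ)) (hS : Subgroup.closure (S : Set G) = ⊤)
    (hT : Subgroup.closure (T : Set H) = ⊤) {x : Spec S hp} (hx : x ∈ boundary S hp) :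
    hψ.specMap hS (hφ.specMap hT x) = x := by
  refine Subtype.ext (NonUnitalAlgHom.ext fun f => ?_)
  change x.1 (hφ.pullback S hT hp (hψ.pullback T hS hp f)) = x.1 f
  rw [← sub_eq_zero, ← map_sub]
  exact hx.2 _ (hψφ.memClosureFinSupp_comp_sub hS hp f.2.2)

/-- The homeomorphism of `p`-harmonic boundaries induced by a regular map `φ` with a regular rough
inverse `ψ`. -/
def IsRegular.boundaryHomeomorph (hφ : IsRegular φ) (hψ : IsRegular ψ)
    (hψφ : IsClose id (ψ ∘ φ)) (hφψ : IsClose id (φ ∘ ψ))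
    (hS : Subgroup.closure (S : Set G) = ⊤) (hT : Subgroup.closure (T : Set H) = ⊤)
    (hp : 1 ≤ p) : boundary S hp ≃ₜ boundary T hp where
  toFun x := ⟨hφ.specMap hT x.1, hφ.specMap_mem_boundary hT x.2⟩
  invFun y := ⟨hψ.specMap hS y.1, hψ.specMap_mem_boundary hS y.2⟩
  left_inv x := Subtype.ext (hφ.specMap_specMap hψ hψφ hS hT x.2)
  right_inv y := Subtype.ext (hψ.specMap_specMap hφ hφψ hT hS y.2)
  continuous_toFun := ((hφ.continuous_specMap hT).comp continuous_subtype_val).subtype_mk _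
  continuous_invFun := ((hψ.continuous_specMap hS).comp continuous_subtype_val).subtype_mk _

end Spectrum

section WordMetric

variable {ι G H : Type*} [Group G] [Group H] {S : Finset G} {T : Finset H} {φ : G → H}

/-- Left multiplication by `k`, as an endomorphism of a Cayley graph. -/
def cayleyMulLeft (S : Set G) (k : G) :
    SimpleGraph.mulCayley S →g SimpleGraph.mulCayley S where
  toFun g := k * g
  map_rel' := SimpleGraph.mulCayley_adj_mul_iff_right.2

theorem mulCayley_connected {S : Set G} (hS : Subgroup.closure S = ⊤) :
    (SimpleGraph.mulCayley S).Connected := by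
  have reachable_one (w : G) : (SimpleGraph.mulCayley S).Reachable 1 w := by
    induction hS ▸ Subgroup.mem_top w using Subgroup.closure_induction with
    | mem s hs =>
      rcases eq_or_ne 1 s with rfl | hs1
      · rfl
      · exact SimpleGraph.Adj.reachable <|
          (SimpleGraph.mulCayley_adj _ _ _).2 ⟨hs1, Or.inl (by simpa using hs)⟩
    | one => rfl
    | mul v w _ _ hv hw =>
      exact hv.trans (by simpa [cayleyMulLeft] using hw.map (cayleyMulLeft S v))
    | inv v _ hv => simpa [cayleyMulLeft] using (hv.map (cayleyMulLeft S v⁻¹)).symm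
  exact { preconnected g h := (reachable_one g).symm.trans (reachable_one h) }

theorem wordDist_self (S : Finset G) (g : G) : wordDist S g g = 0 := by
  simp [wordDist]

theorem wordDist_comm (S : Finset G) (g h : G) : wordDist S g h = wordDist S h g := by
  rw [wordDist, wordDist, SimpleGraph.dist_comm]

theorem wordDist_triangle (hS : Subgroup.closure (S : Set G) = ⊤) (g h k : G) :
    wordDist S g k ≤ wordDist S g h + wordDist S h k := by
  unfold wordDist
  exact_mod_cast (mulCayley_connected hS).dist_triangle

theorem wordDist_mul_left_le (hS : Subgroup.closure (S : Set G) = ⊤) (k g h : G) :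
    wordDist S (k * g) (k * h) ≤ wordDist S g h := by
  obtain ⟨q, hq⟩ := (mulCayley_connected hS).exists_walk_length_eq_dist g h
  rw [wordDist, wordDist, ← hq, ← q.length_map (cayleyMulLeft (S : Set G) k)]
  exact_mod_cast SimpleGraph.dist_le _

theorem inv_mul_mem_pow_length {S : Set G} {g h : G} (q : (SimpleGraph.mulCayley S).Walk g h) :
    g⁻¹ * h ∈ (S ∪ S⁻¹) ^ q.length := by
  induction q with
  | nil => simp
  | @cons g k h hadj q ih =>
    have hgk : g⁻¹ * k ∈ S ∪ S⁻¹ := by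
      simpa using ((SimpleGraph.mulCayley_adj _ _ _).1 hadj).2
    rw [SimpleGraph.Walk.length_cons, pow_succ']
    simpa [mul_assoc] using Set.mul_mem_mul hgk ih

theorem finite_setOf_inv_mul_of_wordDist_le (hS : Subgroup.closure (S : Set G) = ⊤) (R : ℝ) :
    {w : G | ∃ g h, wordDist S g h ≤ R ∧ g⁻¹ * h = w}.Finite := by
  classical
  have finite_pow (n : ℕ) : (((S : Set G) ∪ (S : Set G)⁻¹) ^ n).Finite := by
    exact_mod_cast ((S ∪ S⁻¹) ^ n).finite_toSet
  refine ((Set.finite_Iic ⌊R⌋₊).biUnion fun n _ => finite_pow n).subset ?_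
  rintro w ⟨g, h, hR, rfl⟩
  obtain ⟨q, hq⟩ := (mulCayley_connected hS).exists_walk_length_eq_dist g h
  exact Set.mem_biUnion (Nat.le_floor (hq ▸ hR)) (inv_mul_mem_pow_length q)

theorem isClose_of_wordDist_le (hS : Subgroup.closure (S : Set G) = ⊤) {φ τ : ι → G} {R : ℝ}
    (hR : ∀ i, wordDist S (φ i) (τ i) ≤ R) : IsClose φ τ :=
  (finite_setOf_inv_mul_of_wordDist_le hS R).subset <| by
    rintro _ ⟨i, rfl⟩
    exact ⟨_, _, hR i, rfl⟩

theorem exists_encard_le_of_wordDist_le (hS : Subgroup.closure (S : Set G) = ⊤) (L : ℝ) :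
    ∃ n : ℕ, ∀ A : Set G, (∀ g ∈ A, ∀ g' ∈ A, wordDist S g g' ≤ L) → A.encard ≤ n := by
  let B := finite_setOf_inv_mul_of_wordDist_le hS L
  refine ⟨B.toFinset.card, fun A hA => ?_⟩
  rcases A.eq_empty_or_nonempty with rfl | ⟨g, hg⟩
  · simp
  · rw [← Set.encard_coe_eq_coe_finsetCard, B.coe_toFinset,
      ← (mul_right_injective g⁻¹).encard_image A]
    refine Set.encard_le_encard ?_
    rintro _ ⟨g', hg', rfl⟩
    exact ⟨g, g', hA g hg g' hg', rfl⟩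

theorem IsRoughIsometry.isRegular (hS : Subgroup.closure (S : Set G) = ⊤)
    (hT : Subgroup.closure (T : Set H) = ⊤)
    (hφ : IsRoughIsometry (wordDist S) (wordDist T) φ) : IsRegular φ := by
  obtain ⟨⟨a, b, ha, -, hab⟩, -⟩ := hφ
  have ha0 : 0 < a := zero_lt_one.trans_le ha
  refine ⟨fun w => isClose_of_wordDist_le hT (R := a * wordDist S 1 w + b) fun g => ?_, ?_⟩
  · have : wordDist S g (g * w) ≤ wordDist S 1 w := by
      simpa only [mul_one] using wordDist_mul_left_le hS g 1 w
    exact (hab g (g * w)).2.trans (by gcongr)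
  · obtain ⟨n, hn⟩ := exists_encard_le_of_wordDist_le hS (a * b)
    refine ⟨n, fun h => hn _ fun g hg g' hg' => ?_⟩
    have hgg' := (hab g g').1
    rwa [hg, hg', wordDist_self, sub_nonpos, one_div, inv_mul_le_iff₀ ha0] at hgg'

theorem IsRoughIsometry.exists_roughInverse {X Y : Type*} {dX : X → X → ℝ} {dY : Y → Y → ℝ}
    (symm : ∀ y y', dY y y' = dY y' y) (triangle : ∀ y y' y'', dY y y'' ≤ dY y y' + dY y' y'')
    {φ : X → Y} (hφ : IsRoughIsometry dX dY φ) :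
    ∃ ψ : Y → X, IsRoughIsometry dY dX ψ ∧
      ∃ R, (∀ x, dX (ψ (φ x)) x ≤ R) ∧ ∀ y, dY (φ (ψ y)) y ≤ R := by
  obtain ⟨⟨a, b, ha, hb, hab⟩, c, hc, hsurj⟩ := hφ
  have ha0 : 0 < a := zero_lt_one.trans_le ha
  choose ψ hψ using hsurj
  have dX_le (x x' : X) : dX x x' ≤ a * (dY (φ x) (φ x') + b) := by
    have := (hab x x').1
    rwa [sub_le_iff_le_add, one_div, inv_mul_le_iff₀ ha0] at this
  have dY_comp_le (y y' : Y) : dY (φ (ψ y)) (φ (ψ y')) ≤ dY y y' + 2 * c := by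
    linarith [triangle (φ (ψ y)) y (φ (ψ y')), triangle y y' (φ (ψ y')), hψ y, hψ y',
      symm y' (φ (ψ y'))]
  have le_dY_comp (y y' : Y) : dY y y' ≤ dY (φ (ψ y)) (φ (ψ y')) + 2 * c := by
    linarith [triangle y (φ (ψ y)) y', triangle (φ (ψ y)) (φ (ψ y')) y', hψ y, hψ y',
      symm y (φ (ψ y))]
  have dX_comp_lt (x : X) : dX (ψ (φ x)) x < a * (c + b) :=
    (dX_le _ _).trans_lt (by gcongr; exact hψ _)
  refine ⟨ψ, ⟨⟨a, a * (2 * c + b), ha, by positivity, fun y y' => ⟨?_, ?_⟩⟩, a * (c + b),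
    by positivity, fun x => ⟨φ x, dX_comp_lt x⟩⟩, max (a * (c + b)) c,
    fun x => le_max_of_le_left (dX_comp_lt x).le, fun y => le_max_of_le_right (hψ y).le⟩
  · rw [sub_le_iff_le_add, one_div, inv_mul_le_iff₀ ha0]
    have : 2 * c + b ≤ a * (a * (2 * c + b)) := by
      rw [← mul_assoc]
      exact le_mul_of_one_le_left (by positivity) (one_le_mul_of_one_le_of_one_le ha ha)
    linarith [le_dY_comp y y', (hab (ψ y) (ψ y')).2]
  · calc dX (ψ y) (ψ y') ≤ a * (dY (φ (ψ y)) (φ (ψ y')) + b) := dX_le _ _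
      _ ≤ a * (dY y y' + 2 * c + b) := by gcongr; exact dY_comp_le y y'
      _ = a * dY y y' + a * (2 * c + b) := by ring

end WordMetric

end PHarmonic

theorem theorem2p3_general {G : Type*} {H : Type*} [Group G] [Group H]
    (S : Finset G) (T : Finset H) (hS : Subgroup.closure (S : Set G) = ⊤)
    (hT : Subgroup.closure (T : Set H) = ⊤) {p : ℝ} (hp : 1 ≤ p) (φ : G → H)
    (hφ : PHarmonic.IsRoughIsometry (PHarmonic.wordDist S) (PHarmonic.wordDist T) φ) :
    ∃ Φ : PHarmonic.boundary S hp ≃ₜ PHarmonic.boundary T hp,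
      ∀ (x : PHarmonic.boundary S hp) (F : Filter G),
        Tendsto (PHarmonic.toSpec S hp) F (𝓝 (x : PHarmonic.Spec S hp)) →
        Tendsto (fun g => PHarmonic.toSpec T hp (φ g)) F
          (𝓝 (Φ x : PHarmonic.Spec T hp)) := by
  obtain ⟨ψ, hψ, R, hψφ, hφψ⟩ :=
    hφ.exists_roughInverse (PHarmonic.wordDist_comm T) (PHarmonic.wordDist_triangle hT)
  have hφ_reg : PHarmonic.IsRegular φ := hφ.isRegular hS hT
  have hψ_reg : PHarmonic.IsRegular ψ := hψ.isRegular hT hS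
  have hψφ_close : PHarmonic.IsClose id (ψ ∘ φ) := PHarmonic.isClose_of_wordDist_le hS fun g =>
    (PHarmonic.wordDist_comm S _ _).trans_le (hψφ g)
  have hφψ_close : PHarmonic.IsClose id (φ ∘ ψ) := PHarmonic.isClose_of_wordDist_le hT fun h =>
    (PHarmonic.wordDist_comm T _ _).trans_le (hφψ h)
  refine ⟨hφ_reg.boundaryHomeomorph hψ_reg hψφ_close hφψ_close hS hT hp, fun x F hF => ?_⟩
  have toSpec_comp : (fun g => PHarmonic.toSpec T hp (φ g)) =
      hφ_reg.specMap hT ∘ PHarmonic.toSpec S hp :=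
    funext fun g => (hφ_reg.specMap_toSpec hT g).symm
  rw [toSpec_comp]
  exact ((hφ_reg.continuous_specMap hT).tendsto (x : PHarmonic.Spec S hp)).comp hF

theorem theorem2p3 {G : Type*} {H : Type*} [Group G] [Group H]
    (S : Finset G) (T : Finset H) (hS : PHarmonic.IsSymmGen S) (hT : PHarmonic.IsSymmGen T)
    {p : ℝ} (hp : 1 ≤ p) (φ : G → H)
    (hφ : PHarmonic.IsRoughIsometry (PHarmonic.wordDist S) (PHarmonic.wordDist T) φ) :
    ∃ Φ : PHarmonic.boundary S hp ≃ₜ PHarmonic.boundary T hp,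
      ∀ (x : PHarmonic.boundary S hp) (F : Filter G),
        Tendsto (PHarmonic.toSpec S hp) F (𝓝 (x : PHarmonic.Spec S hp)) →
        Tendsto (fun g => PHarmonic.toSpec T hp (φ g)) F
          (𝓝 (Φ x : PHarmonic.Spec T hp)) :=
  theorem2p3_general S T hS.closure_eq_top hT.closure_eq_top hp φ hφ
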